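/- **Model.** A computational DAG $G=(V,E)$ is a finite directed acyclic graph; $\Delta_{in}$ is its largest in-degree. In multiprocessor red-blue pebbling with $k$ processors, fast memory size $r$ and I/O cost $g$ ($k,r,g\in\mathbb{Z}^+$), a configuration consists of sets $R^1,\dots,R^k\subseteq V$ (red pebbles of each processor) with $|R^j|\le r$, and a set $B\subseteq V$ (blue pebbles); initially all are empty. In one step, either a nonempty set of processors acts simultaneously, each on one node $v$ of its choice, all by the same one of the following three rules (for processor $j$): *save* (if $v\in R^j$, add $v$ to $B$), *load* (if $v\in B$, add $v$ to $R^j$), *compute* (if all in-neighbours of $v$ are in $R^j$, add $v$ to $R^j$); or a single pebble is removed. A save or load step costs $g$, a compute step costs $1$, a removal is free. A pebbling is a sequence of steps after which every sink has a pebble; $\mathrm{OPT}$ is the minimum total cost of a pebbling. **Greedy pebblings.** A node is *ready* if it has not been computed yet by any processor, but each of its in-neighbours has been computed by some processor. At the start, and right after each step in which next-goal nodes are computed, every processor is assigned a next-goal node: in some arbitrary order, each processor takes, among the ready nodes not yet taken, one with the largest number of in-neighbours that carry a red pebble of this processor at this moment (ties broken arbitrarily); a processor gets no goal only if no ready node is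 left. Alternatively, the largest fraction of such in-neighbours is used, where the fraction for a source is interpreted as $0$ or as $1$. Then all processors compute their next-goal nodes concurrently, in one step. Before and after this step the strategy is free to perform any saves, loads and removals, and any recomputations by a processor of nodes that this same processor computed before (a processor without a goal may also recompute such a node in the common step); no node is computed by a processor for the first time in any other way. A pebbling of this form is called greedy. **Lemma.** Let $k=2$. 1. For all integers $\Delta\ge 0$ and $g\ge 1$ there are an $r\ge\Delta+1$ and a sequence of DAGs $G_1,G_2,\dots$ with $|V(G_i)|\to\infty$ and $\Delta_{in}(G_i)=\Delta$ for all $i$, such that greedy pebblings are asymptotically worse than the optimum by a factor of at least $\frac15\Delta-1$. 2. For every integer $g\ge2$ there is a sequence of DAGs $G_1,G_2,\dots$ with $|V(G_i)|\to\infty$ such that, whenever the fast memory is unbounded (that is, for any sizes $r_i\ge|V(G_i)|$), greedy pebblings are asymptotically worse than the optimum by a factor of at least $\frac23 g+1$. Here "asymptotically worse by a factor of at least $c$" means: for every form of the greedy rule (number, or fraction with either convention for sources) and every $\varepsilon>0$, for all sufficiently large $i$, every greedy pebbling of $G_i$ has cost at least $(c-\varepsilon)\cdot\mathrm{OPT}(G_i)$.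 -/

import Mathlib

open Filter

/-- A computational DAG: a finite directed graph without directed cycles.
`graph.Adj u v` is the edge from `u` to `v`, so `u` is an in-neighbour of `v`. -/
structure CompDAG where
  V : Type
  finite : Finite V
  graph : Digraph V
  acyclic : ∀ v : V, ¬ Relation.TransGen graph.Adj v v

namespace CompDAG

/-- The number `n` of nodes. -/
noncomputable def size (G : CompDAG) : ℕ := Nat.card G.V

/-- The set of in-neighbours (predecessors) of `v`. -/
def preds (G : CompDAG) (v : G.V) : Set G.V := {u | G.graph.Adj u v}

noncomputable def inDegree (G : CompDAG) (v : G.V) : ℕ := (G.preds v).ncard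

/-- The largest in-degree of a node. -/
noncomputable def maxInDegree (G : CompDAG) : ℕ := ⨆ v : G.V, G.inDegree v

/-- Sinks: nodes without outgoing edges. -/
def sinks (G : CompDAG) : Set G.V := {v | ∀ w, ¬ G.graph.Adj v w}

end CompDAG

/-- A configuration: the red pebbles of each of the `k` processors, and the blue pebbles. -/
structure Config (V : Type) (k : ℕ) where
  red : Fin k → Set V
  blue : Set V

/-- A choice of at most one node for each processor; `none` means that the processor does not
take part. -/
abbrev Selection (V : Type) (k : ℕ) := Fin k → Option V

/-- The transition rules. In `save`, `load` and `compute` a nonempty set of processors acts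
simultaneously, each on one node. -/
inductive Move (V : Type) (k : ℕ) where
  | save (f : Selection V k)
  | load (f : Selection V k)
  | compute (f : Selection V k)
  | removeRed (p : Fin k) (v : V)
  | removeBlue (v : V)

namespace Config

/-- The initial configuration has no pebbles. -/
def init (V : Type) (k : ℕ) : Config V k := ⟨fun _ => ∅, ∅⟩

/-- Each processor holds at most `r` red pebbles. -/
def Valid {V : Type} {k : ℕ} (r : ℕ) (C : Config V k) : Prop :=
  ∀ p, (C.red p).ncard ≤ r

/-- Every sink has a pebble. -/
def Terminal {k : ℕ} (G : CompDAG) (C : Config G.V k) : Prop :=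
  ∀ v ∈ G.sinks, v ∈ C.blue ∨ ∃ p, v ∈ C.red p

end Config

namespace Move

/-- A move may be applied in the configuration `C`. -/
def Applicable {k : ℕ} (G : CompDAG) (C : Config G.V k) : Move G.V k → Prop
  | save f => (∃ p v, f p = some v) ∧ ∀ p v, f p = some v → v ∈ C.red p
  | load f => (∃ p v, f p = some v) ∧ ∀ p v, f p = some v → v ∈ C.blue
  | compute f => (∃ p v, f p = some v) ∧ ∀ p v, f p = some v → G.preds v ⊆ C.red p
  | removeRed p v => v ∈ C.red p
  | removeBlue v => v ∈ C.blue

/-- The configuration after a move. -/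
def apply {V : Type} {k : ℕ} (C : Config V k) : Move V k → Config V k
  | save f => ⟨C.red, C.blue ∪ {v | ∃ p, f p = some v}⟩
  | load f => ⟨fun p => C.red p ∪ {v | f p = some v}, C.blue⟩
  | compute f => ⟨fun p => C.red p ∪ {v | f p = some v}, C.blue⟩
  | removeRed p v => ⟨fun q => {w | w ∈ C.red q ∧ ¬ (q = p ∧ w = v)}, C.blue⟩
  | removeBlue v => ⟨C.red, C.blue \ {v}⟩

/-- An I/O move costs `g`, a compute move costs `1`, removing a pebble is free. -/
def cost {V : Type} {k : ℕ} (g : ℕ) : Move V k → ℕ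
  | save _ => g
  | load _ => g
  | compute _ => 1
  | removeRed _ _ => 0
  | removeBlue _ => 0

def IsCompute {V : Type} {k : ℕ} : Move V k → Prop
  | compute _ => True
  | _ => False

end Move

/-- The moves can be carried out one after the other from `C`, through valid configurations, and
end in a terminal configuration. -/
def PebblesFrom {k : ℕ} (G : CompDAG) (r : ℕ) : Config G.V k → List (Move G.V k) → Prop
  | C, [] => C.Terminal G
  | C, m :: ms => m.Applicable G C ∧ (m.apply C).Valid r ∧ PebblesFrom G r (m.apply C) ms

/-- A pebbling strategy with `k` processors of fast memory size `r`. -/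
def IsPebbling (G : CompDAG) (k r : ℕ) (P : List (Move G.V k)) : Prop :=
  PebblesFrom G r (Config.init G.V k) P

/-- The total cost of a sequence of moves. -/
def pebblingCost {V : Type} {k : ℕ} (g : ℕ) (P : List (Move V k)) : ℕ :=
  (P.map (Move.cost g)).sum

/-- The optimum: the minimum cost of a pebbling strategy. -/
noncomputable def pebblingOPT (G : CompDAG) (k r g : ℕ) : ℕ :=
  sInf {c | ∃ P : List (Move G.V k), IsPebbling G k r P ∧ pebblingCost g P = c}

/-- What a processor maximizes: the number of its red pebbles on the in-neighbours of a node, or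
the fraction of in-neighbours that have one. For the fraction, sources (whose ratio is `0 / 0`)
count as `1` or as `0`, as the flag says. -/
inductive GreedyRule where
  | count
  | fraction (sourcesAreOne : Bool)

open Classical in
/-- The score of the node `v` for the processor `p` in the configuration `C`. -/
noncomputable def GreedyRule.score {k : ℕ} (rule : GreedyRule) (G : CompDAG)
    (C : Config G.V k) (p : Fin k) (v : G.V) : ℚ :=
  match rule with
  | .count => ((G.preds v ∩ C.red p).ncard : ℚ)
  | .fraction b =>
      if G.inDegree v = 0 then (if b = true then 1 else 0)
      else ((G.preds v ∩ C.red p).ncard : ℚ) / (G.inDegree v : ℚ)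

/-- `hist p` is the set of nodes computed so far by the processor `p`. A node is ready if it has
not been computed by any processor, but each of its in-neighbours has. -/
def IsReady {k : ℕ} (G : CompDAG) (hist : Fin k → Set G.V) (v : G.V) : Prop :=
  (∀ p, v ∉ hist p) ∧ ∀ u ∈ G.preds v, ∃ p, u ∈ hist p

/-- `goal` is a greedy choice of next-goal nodes: in some order of the processors, each of them
takes a ready node of the highest score among those not yet taken (ties are broken arbitrarily),
and gets no goal only if every ready node is taken. The arbitrary order stands for the arbitrary
resolution of conflicts between processors that prefer the same node. -/
def IsGreedyChoice {k : ℕ} (rule : GreedyRule) (G : CompDAG) (C : Config G.V k)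
    (hist : Fin k → Set G.V) (goal : Selection G.V k) : Prop :=
  ∃ order : Equiv.Perm (Fin k), ∀ p,
    let avail : Set G.V :=
      {v | IsReady G hist v ∧ ∀ q, order q < order p → goal q ≠ some v}
    (goal p = none → avail = ∅) ∧
    ∀ v, goal p = some v → v ∈ avail ∧ ∀ w ∈ avail, rule.score G C p w ≤ rule.score G C p v

/-- `GreedyFrom rule G C hist goal P`: from the configuration `C`, with computation history `hist`
and current next-goal nodes `goal`, the moves `P` follow the greedy rule.
I/O moves and removals are free to choose, and so are recomputations by a processor of nodes that
it has computed before. A node is computed by a processor for the first time only in a move in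
which all processors compute their next-goal nodes concurrently (a processor without a goal may
idle or recompute); the new next-goal nodes are then chosen according to the configuration right
after this move. -/
inductive GreedyFrom {k : ℕ} (rule : GreedyRule) (G : CompDAG) :
    Config G.V k → (Fin k → Set G.V) → Selection G.V k → List (Move G.V k) → Prop
  | done (C : Config G.V k) (hist : Fin k → Set G.V) (goal : Selection G.V k) :
      GreedyFrom rule G C hist goal []
  | other (C : Config G.V k) (hist : Fin k → Set G.V) (goal : Selection G.V k)
      (m : Move G.V k) (P : List (Move G.V k)) (hm : ¬ m.IsCompute)
      (h : GreedyFrom rule G (m.apply C) hist goal P) :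
      GreedyFrom rule G C hist goal (m :: P)
  | recompute (C : Config G.V k) (hist : Fin k → Set G.V) (goal : Selection G.V k)
      (f : Selection G.V k) (P : List (Move G.V k))
      (hf : ∀ p v, f p = some v → v ∈ hist p)
      (h : GreedyFrom rule G ((Move.compute f).apply C) hist goal P) :
      GreedyFrom rule G C hist goal (Move.compute f :: P)
  | advance (C : Config G.V k) (hist : Fin k → Set G.V) (goal goal' : Selection G.V k)
      (f : Selection G.V k) (P : List (Move G.V k))
      (hgoal : ∀ p v, goal p = some v → f p = some v)
      (hidle : ∀ p, goal p = none → ∀ v, f p = some v → v ∈ hist p)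
      (hchoice : IsGreedyChoice rule G ((Move.compute f).apply C)
        (fun p => hist p ∪ {v | f p = some v}) goal')
      (h : GreedyFrom rule G ((Move.compute f).apply C)
        (fun p => hist p ∪ {v | f p = some v}) goal' P) :
      GreedyFrom rule G C hist goal (Move.compute f :: P)

/-- A pebbling strategy that follows the greedy rule from the start. -/
def IsGreedyPebbling (rule : GreedyRule) (G : CompDAG) (k r : ℕ)
    (P : List (Move G.V k)) : Prop :=
  IsPebbling G k r P ∧
    ∃ goal : Selection G.V k,
      IsGreedyChoice rule G (Config.init G.V k) (fun _ => ∅) goal ∧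
      GreedyFrom rule G (Config.init G.V k) (fun _ => ∅) goal P

/-- On the DAGs `G i`, with `k` processors of fast memory size `r i`, every greedy pebbling is
asymptotically (for `i → ∞`) worse than the optimum by a factor of at least `c`, for every form
of the greedy rule. -/
def GreedyWorseByFactor (k g : ℕ) (r : ℕ → ℕ) (G : ℕ → CompDAG) (c : ℝ) : Prop :=
  ∀ rule : GreedyRule, ∀ ε : ℝ, 0 < ε → ∀ᶠ i in atTop,
    ∀ P : List (Move (G i).V k), IsGreedyPebbling rule (G i) k (r i) P →
      (c - ε) * (pebblingOPT (G i) k (r i) g : ℝ) ≤ (pebblingCost g P : ℝ)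

/-!
All DAGs used consist of two directed paths with the same number of nodes, where moreover both nodes
with a given index share some in-neighbours, the rung, which are all taken from the first path. The
predecessor on its own path is then one more in-neighbour with a red pebble, so under every form of
the greedy rule each processor stays on one path forever. What the processor on the second path
needs from the rungs has to be saved by the other processor and loaded by it, since a greedy
processor never recomputes what another one has computed.

With unbounded memory, let every node of the first path but the last two be in a rung. Each index
then costs a compute, a save and a load, that is `2 * g + 1`, whereas a single processor computes
its two nodes at cost `2`.

With limited memory, let the rungs of even and odd indices be two disjoint blocks of `m` nodes, and
let the memory size be `m + 2`. After a node has been computed, the memory holds hardly anything but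
its in-neighbours, so the processor on the second path loads a whole block for each index, at cost
`g * m + 1`. In a cheap pebbling each processor keeps one of the blocks and computes, on both paths,
the nodes with the corresponding parity of the index. If one path is one node ahead of the other,
the processors always act on different paths, and two nodes, one on each path, together cost
`2 * g + 1`: a load of the path predecessors, a compute and a save.
-/

namespace CompDAG

variable {G : CompDAG}

instance : Finite G.V := G.finite

theorem notMem_preds_self (v : G.V) : v ∉ G.preds v := fun h => G.acyclic v (.single h)

/-- A set of nodes that contains all in-neighbours of its elements: the possible sets of nodes
computed so far. -/
def IsPredClosed (G : CompDAG) (S : Set G.V) : Prop := ∀ v ∈ S, G.preds v ⊆ S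

theorem isPredClosed_univ : G.IsPredClosed Set.univ := fun _ _ => Set.subset_univ _

theorem exists_mem_forall_notMem_preds {S : Set G.V} (hS : S.Nonempty) :
    ∃ v ∈ S, ∀ w ∈ S, v ∉ G.preds w := by
  have : Std.Irrefl (Function.swap (Relation.TransGen G.graph.Adj)) := ⟨G.acyclic⟩
  have hwf := Finite.wellFounded_of_trans_of_irrefl
    (Function.swap (Relation.TransGen G.graph.Adj))
  obtain ⟨v, hv, hmax⟩ := hwf.has_min S hS
  exact ⟨v, hv, fun w hw hvw => hmax w hw (.single hvw)⟩

theorem IsPredClosed.induction {motive : Set G.V → Prop} (empty : motive ∅)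
    (insert : ∀ S v, v ∉ S → G.preds v ⊆ S → motive S → motive (insert v S))
    {S : Set G.V} (hS : G.IsPredClosed S) : motive S := by
  induction hN : S.ncard generalizing S with
  | zero => rwa [(Set.ncard_eq_zero (Set.toFinite S)).1 hN]
  | succ N ih =>
    obtain ⟨v, hv, hmax⟩ := exists_mem_forall_notMem_preds
      (Set.nonempty_of_ncard_ne_zero (hN.trans_ne N.succ_ne_zero))
    have hclosed : G.IsPredClosed (S \ {v}) := fun w hw =>
      Set.subset_sdiff_singleton (hS w hw.1) (hmax w hw.1)
    have hcard : (S \ {v}).ncard = N := by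
      rw [Set.ncard_sdiff_singleton_of_mem hv, hN, Nat.add_sub_cancel]
    rw [← Set.insert_sdiff_self_of_mem hv]
    exact insert _ v (fun h => h.2 rfl)
      (Set.subset_sdiff_singleton (hS v hv) (notMem_preds_self v)) (ih hclosed hcard)

end CompDAG

theorem Config.Valid.mono {V : Type} [Finite V] {k r : ℕ} {C C' : Config V k} (h : C'.Valid r)
    (hsub : ∀ p, C.red p ⊆ C'.red p) : C.Valid r :=
  fun p => (Set.ncard_le_ncard (hsub p) (Set.toFinite _)).trans (h p)

theorem pebblingCost_cons {V : Type} {k g : ℕ} (m : Move V k) (P : List (Move V k)) :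
    pebblingCost g (m :: P) = m.cost g + pebblingCost g P := rfl

/-- The selection in which only the processor `p` acts, on the node `v`. -/
def Selection.single {V : Type} {k : ℕ} (p : Fin k) (v : V) : Selection V k :=
  Function.update (fun _ => none) p (some v)

namespace Selection

variable {V : Type} {k : ℕ}

theorem single_eq_some {p q : Fin k} {v w : V} : single p v q = some w ↔ q = p ∧ w = v := by
  by_cases h : q = p <;> simp [single, h, eq_comm]

theorem exists_single_eq_some (p : Fin k) (v : V) : ∃ q w, single p v q = some w :=
  ⟨p, v, single_eq_some.2 ⟨rfl, rfl⟩⟩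

theorem union_setOf_single (R : Fin k → Set V) (p : Fin k) (v : V) :
    (fun q => R q ∪ {w | single p v q = some w}) = Function.update R p (insert v (R p)) := by
  funext q
  ext w
  by_cases h : q = p
  · subst h
    simp [single_eq_some]
  · simp [single_eq_some, h]

theorem union_setOf_exists_single (B : Set V) (p : Fin k) (v : V) :
    B ∪ {w | ∃ q, single p v q = some w} = insert v B := by
  ext w
  simp [single_eq_some]

end Selection

/-! ### Upper bounds for the optimum -/

/-- The configuration `C` respects the memory size `r`, and a pebbling can be completed from it with
cost at most `c`. -/
def CompletableWithin {k : ℕ} (G : CompDAG) (r g : ℕ) (C : Config G.V k) (c : ℕ) : Prop :=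
  C.Valid r ∧ ∃ P, PebblesFrom G r C P ∧ pebblingCost g P ≤ c

namespace CompletableWithin

variable {G : CompDAG} {k r g c c' : ℕ} {R R' : Fin k → Set G.V} {B : Set G.V}

theorem mono {C : Config G.V k} (h : CompletableWithin G r g C c) (hc : c ≤ c') :
    CompletableWithin G r g C c' :=
  let ⟨hC, P, hP, hcost⟩ := h
  ⟨hC, P, hP, hcost.trans hc⟩

theorem pebblingOPT_le (h : CompletableWithin G r g (Config.init G.V k) c) :
    pebblingOPT G k r g ≤ c :=
  let ⟨_, P, hP, hcost⟩ := h
  le_trans (Nat.sInf_le ⟨P, hP, rfl⟩) hcost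

theorem of_terminal {C : Config G.V k} (hC : C.Valid r) (hT : C.Terminal G) :
    CompletableWithin G r g C 0 :=
  ⟨hC, [], hT, le_rfl⟩

theorem move {C : Config G.V k} {m : Move G.V k} (hC : C.Valid r) (hm : m.Applicable G C)
    (h : CompletableWithin G r g (m.apply C) c) : CompletableWithin G r g C (c + m.cost g) :=
  let ⟨hC', P, hP, hcost⟩ := h
  ⟨hC, m :: P, ⟨hm, hC', hP⟩, by rw [pebblingCost_cons, add_comm]; gcongr⟩

theorem load {f : Selection G.V k} (hf : ∃ p v, f p = some v) (hB : ∀ p v, f p = some v → v ∈ B)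
    (h : CompletableWithin G r g ⟨fun p => R p ∪ {v | f p = some v}, B⟩ c) :
    CompletableWithin G r g ⟨R, B⟩ (c + g) :=
  move (m := .load f) (h.1.mono fun _ => Set.subset_union_left) ⟨hf, hB⟩ h

theorem compute {f : Selection G.V k} (hf : ∃ p v, f p = some v)
    (hpreds : ∀ p v, f p = some v → G.preds v ⊆ R p)
    (h : CompletableWithin G r g ⟨fun p => R p ∪ {v | f p = some v}, B⟩ c) :
    CompletableWithin G r g ⟨R, B⟩ (c + 1) :=
  move (m := .compute f) (h.1.mono fun _ => Set.subset_union_left) ⟨hf, hpreds⟩ h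

theorem save {f : Selection G.V k} (hf : ∃ p v, f p = some v) (hR : ∀ p v, f p = some v → v ∈ R p)
    (h : CompletableWithin G r g ⟨R, B ∪ {v | ∃ p, f p = some v}⟩ c) :
    CompletableWithin G r g ⟨R, B⟩ (c + g) :=
  move (m := .save f) h.1 ⟨hf, hR⟩ h

theorem removeRed {p : Fin k} {v : G.V} (hR : (⟨R, B⟩ : Config G.V k).Valid r)
    (h : CompletableWithin G r g ⟨fun q => {w | w ∈ R q ∧ ¬ (q = p ∧ w = v)}, B⟩ c) :
    CompletableWithin G r g ⟨R, B⟩ c := by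
  by_cases hv : v ∈ R p
  · exact move (m := .removeRed p v) hR hv h
  · convert h using 3 with q
    ext w
    exact ⟨fun hw => ⟨hw, by rintro ⟨rfl, rfl⟩; exact hv hw⟩, And.left⟩

theorem of_red_subset (hR : (⟨R, B⟩ : Config G.V k).Valid r) (hsub : ∀ p, R' p ⊆ R p)
    (h : CompletableWithin G r g ⟨R', B⟩ c) : CompletableWithin G r g ⟨R, B⟩ c := by
  have key : ∀ S : Set (Fin k × G.V),
      CompletableWithin G r g ⟨fun q => {w | w ∈ R q ∧ (q, w) ∉ S}, B⟩ c →
        CompletableWithin G r g ⟨R, B⟩ c := by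
    intro S
    induction S, S.toFinite using Set.Finite.induction_on with
    | empty => simp
    | @insert pv S _ _ ih =>
      refine fun h => ih (removeRed (p := pv.1) (v := pv.2) (hR.mono fun q w hw => hw.1) ?_)
      convert h using 3 with q
      ext w
      simp only [Set.mem_ofPred_eq, Set.mem_insert_iff, Prod.ext_iff, not_or]
      tauto
  refine key {x | x.2 ∉ R' x.1} ?_
  convert h using 3 with q
  ext w
  simpa using @hsub q w

theorem loadSet (p : Fin k) {S : Set G.V} (hS : S ⊆ B)
    (h : CompletableWithin G r g ⟨Function.update R p (R p ∪ S), B⟩ c) :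
    CompletableWithin G r g ⟨R, B⟩ (c + g * S.ncard) := by
  induction S, S.toFinite using Set.Finite.induction_on generalizing c with
  | empty => simpa using h
  | @insert v S hv hSfin ih =>
    obtain ⟨hvB, hSB⟩ := Set.insert_subset_iff.1 hS
    have hload : CompletableWithin G r g ⟨Function.update R p (R p ∪ S), B⟩ (c + g) := by
      refine load (Selection.exists_single_eq_some p v) (fun q w hw => ?_) ?_
      · rwa [(Selection.single_eq_some.1 hw).2]
      · rw [Selection.union_setOf_single, Function.update_idem, Function.update_self,
          ← Set.union_insert]
        exact h
    refine (ih hSB hload).mono (le_of_eq ?_)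
    rw [Set.ncard_insert_of_notMem hv hSfin]
    ring

theorem computeNode (p : Fin k) {v : G.V} (hpreds : G.preds v ⊆ R p)
    (h : CompletableWithin G r g ⟨Function.update R p (insert v (R p)), B⟩ c) :
    CompletableWithin G r g ⟨R, B⟩ (c + 1) := by
  refine compute (Selection.exists_single_eq_some p v) (fun q w hw => ?_) ?_
  · obtain ⟨rfl, rfl⟩ := Selection.single_eq_some.1 hw
    exact hpreds
  · rwa [Selection.union_setOf_single]

theorem saveNode {p : Fin k} {v : G.V} (hv : v ∈ R p)
    (h : CompletableWithin G r g ⟨R, insert v B⟩ c) : CompletableWithin G r g ⟨R, B⟩ (c + g) := by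
  refine save (Selection.exists_single_eq_some p v) (fun q w hw => ?_) ?_
  · obtain ⟨rfl, rfl⟩ := Selection.single_eq_some.1 hw
    exact hv
  · rwa [Selection.union_setOf_exists_single]

theorem loadComputeSaveNode (p : Fin k) {v : G.V} (hpreds : G.preds v ⊆ B)
    (hr : G.inDegree v + 1 ≤ r)
    (h : CompletableWithin G r g (⟨fun _ => ∅, insert v B⟩ : Config G.V k) c) :
    CompletableWithin G r g (⟨fun _ => ∅, B⟩ : Config G.V k) (c + (g * r + 1)) := by
  set R : Fin k → Set G.V := Function.update (fun _ => ∅) p (insert v (G.preds v))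
  have hR : ∀ B' : Set G.V, (⟨R, B'⟩ : Config G.V k).Valid r := by
    intro B' q
    by_cases hq : q = p
    · subst hq
      simpa [R] using (Set.ncard_insert_le v (G.preds v)).trans hr
    · simp [R, hq]
  have hsave : CompletableWithin G r g ⟨R, B⟩ (c + g) :=
    saveNode (p := p) (v := v) (by simp [R]) (of_red_subset (hR _) (by simp) h)
  have hcompute :
      CompletableWithin G r g ⟨Function.update (fun _ => ∅) p (∅ ∪ G.preds v), B⟩ (c + g + 1) :=
    computeNode p (v := v) (by simp) (by simpa [R] using hsave)
  refine (loadSet p hpreds hcompute).mono ?_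
  calc c + g + 1 + g * (G.preds v).ncard = c + (g * (G.inDegree v + 1) + 1) := by
        rw [CompDAG.inDegree]; ring
    _ ≤ c + (g * r + 1) := by gcongr

theorem savePredClosed (p : Fin k) {S : Set G.V} (hS : G.IsPredClosed S)
    (hr : ∀ v, G.inDegree v + 1 ≤ r)
    (h : CompletableWithin G r g (⟨fun _ => ∅, S⟩ : Config G.V k) c) :
    CompletableWithin G r g (Config.init G.V k) (c + S.ncard * (g * r + 1)) := by
  refine CompDAG.IsPredClosed.induction (motive := fun S => ∀ c,
    CompletableWithin G r g (⟨fun _ => ∅, S⟩ : Config G.V k) c →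
      CompletableWithin G r g (Config.init G.V k) (c + S.ncard * (g * r + 1))) ?_ ?_ hS c h
  · simp [Config.init]
  · intro S v hv hpreds ih c h
    refine (ih _ (loadComputeSaveNode p hpreds (hr v) h)).mono (le_of_eq ?_)
    rw [Set.ncard_insert_of_notMem hv (Set.toFinite S)]
    ring

theorem computePredClosed (p : Fin k) {S : Set G.V} (hS : G.IsPredClosed S)
    (h : CompletableWithin G r g ⟨Function.update (fun _ => ∅) p S, ∅⟩ c) :
    CompletableWithin G r g (Config.init G.V k) (c + S.ncard) := by
  refine CompDAG.IsPredClosed.induction (motive := fun S => ∀ c,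
    CompletableWithin G r g ⟨Function.update (fun _ => ∅) p S, ∅⟩ c →
      CompletableWithin G r g (Config.init G.V k) (c + S.ncard)) ?_ ?_ hS c h
  · simp [Config.init]
  · intro S v hv hpreds ih c h
    have hcompute : CompletableWithin G r g ⟨Function.update (fun _ => ∅) p S, ∅⟩ (c + 1) :=
      computeNode p (v := v) (by simpa using hpreds) (by simpa using h)
    refine (ih _ hcompute).mono (le_of_eq ?_)
    rw [Set.ncard_insert_of_notMem hv (Set.toFinite S)]
    ring

end CompletableWithin

theorem pebblingOPT_le_size {G : CompDAG} {k r g : ℕ} (p : Fin k) (hr : G.size ≤ r) :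
    pebblingOPT G k r g ≤ G.size := by
  have hvalid : (⟨Function.update (fun _ => ∅) p Set.univ, ∅⟩ : Config G.V k).Valid r := fun _ =>
    ((Set.ncard_le_ncard (Set.subset_univ _) (Set.toFinite _)).trans_eq (Set.ncard_univ _)).trans hr
  have hterminal : (⟨Function.update (fun _ => ∅) p Set.univ, ∅⟩ : Config G.V k).Terminal G :=
    fun v _ => Or.inr ⟨p, by simp⟩
  have h := CompletableWithin.computePredClosed p CompDAG.isPredClosed_univ
    (CompletableWithin.of_terminal (g := g) hvalid hterminal)
  rw [zero_add, Set.ncard_univ] at h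
  exact h.pebblingOPT_le

theorem Selection.exists_setOf_eq_some_eq {V : Type} {k : ℕ} {A : Fin k → Set V}
    (hA : ∀ p, (A p).Subsingleton) : ∃ f : Selection V k, ∀ p, {v | f p = some v} = A p := by
  refine Classical.skolem (p := fun p o => {v | o = some v} = A p).1 fun p => ?_
  rcases (hA p).eq_empty_or_singleton with h | ⟨v, h⟩
  · exact ⟨none, by simp [h]⟩
  · exact ⟨some v, by simp [h]⟩

theorem CompletableWithin.loadComputeSave {G : CompDAG} {k r g c : ℕ} {R A A' : Fin k → Set G.V}
    {B : Set G.V} (hA : ∀ p, (A p).Subsingleton) (hA' : ∀ p, (A' p).Subsingleton)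
    (hne : ∃ p, (A p).Nonempty) (hne' : ∃ p, (A' p).Nonempty) (hB : ∀ p, A p ⊆ B)
    (hpreds : ∀ p, ∀ v ∈ A' p, G.preds v ⊆ R p ∪ A p) (hr : ∀ p, (R p).ncard + 2 ≤ r)
    (h : CompletableWithin G r g ⟨R, B ∪ ⋃ p, A' p⟩ c) :
    CompletableWithin G r g ⟨R, B⟩ (c + (2 * g + 1)) := by
  have hvalid : ∀ p, (R p ∪ A p ∪ A' p).ncard ≤ r := fun p => calc
    _ ≤ (R p ∪ A p).ncard + (A' p).ncard := Set.ncard_union_le _ _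
    _ ≤ (R p).ncard + (A p).ncard + (A' p).ncard := by gcongr; exact Set.ncard_union_le _ _
    _ ≤ (R p).ncard + 1 + 1 := by
      gcongr
      exacts [Set.ncard_le_one_iff_subsingleton.2 (hA p),
        Set.ncard_le_one_iff_subsingleton.2 (hA' p)]
    _ ≤ r := hr p
  obtain ⟨f, hf⟩ := Selection.exists_setOf_eq_some_eq hA
  obtain ⟨f', hf'⟩ := Selection.exists_setOf_eq_some_eq hA'
  simp only [← hf, ← hf', ← Set.ofPred_exists] at *
  refine (load hne hB (compute hne' hpreds (save hne' (fun p v hv => Or.inr hv)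
    (of_red_subset hvalid (fun p v hv => Or.inl (Or.inl hv)) h)))).mono (le_of_eq ?_)
  ring

/-! ### Greedy choices -/

theorem GreedyRule.score_lt_score {k : ℕ} (rule : GreedyRule) {G : CompDAG} {C : Config G.V k}
    {p : Fin k} {v w : G.V} (hdeg : G.inDegree w = G.inDegree v)
    (hlt : (G.preds w ∩ C.red p).ncard < (G.preds v ∩ C.red p).ncard) :
    rule.score G C p w < rule.score G C p v := by
  cases rule with
  | count => exact Nat.cast_lt.2 hlt
  | fraction b =>
    have hpos : 0 < G.inDegree v := (Nat.zero_lt_of_lt hlt).trans_le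
      (Set.ncard_le_ncard Set.inter_subset_left (Set.toFinite _))
    simp only [score, hdeg, hpos.ne', if_false]
    gcongr

namespace IsGreedyChoice

variable {k : ℕ} {rule : GreedyRule} {G : CompDAG} {C : Config G.V k} {hist : Fin k → Set G.V}
  {goal : Selection G.V k}

theorem isReady (h : IsGreedyChoice rule G C hist goal) {p : Fin k} {v : G.V}
    (hp : goal p = some v) : IsReady G hist v :=
  let ⟨_, hgreedy⟩ := h
  ((hgreedy p).2 v hp).1.1

theorem eq_of_eq_some (h : IsGreedyChoice rule G C hist goal) {p q : Fin k} {v : G.V}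
    (hp : goal p = some v) (hq : goal q = some v) : p = q := by
  obtain ⟨order, hgreedy⟩ := h
  by_contra hne
  rcases lt_or_gt_of_ne (order.injective.ne hne) with hlt | hlt
  · exact ((hgreedy q).2 v hq).1.2 p hlt hp
  · exact ((hgreedy p).2 v hp).1.2 q hlt hq

theorem exists_eq_some_of_le_ncard (h : IsGreedyChoice rule G C hist goal)
    (hk : k ≤ {v | IsReady G hist v}.ncard) (p : Fin k) : ∃ v, goal p = some v := by
  obtain ⟨order, hgreedy⟩ := h
  by_contra! hnone
  have hp : goal p = none := Option.eq_none_iff_forall_ne_some.2 hnone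
  have htaken : some '' {v | IsReady G hist v} ⊆ goal '' {p}ᶜ := by
    rintro _ ⟨v, hv, rfl⟩
    by_contra hfree
    refine Set.notMem_empty v ((hgreedy p).1 hp ▸ ⟨hv, fun q hq hqv => hfree ⟨q, ?_, hqv⟩⟩)
    rintro rfl
    exact hq.false
  have hcard : {v | IsReady G hist v}.ncard ≤ k - 1 := calc
    _ = (some '' {v | IsReady G hist v}).ncard :=
      (Set.ncard_image_of_injective _ (Option.some_injective _)).symm
    _ ≤ (goal '' {p}ᶜ).ncard := Set.ncard_le_ncard htaken (Set.toFinite _)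
    _ ≤ ({p}ᶜ : Set (Fin k)).ncard := Set.ncard_image_le
    _ = k - 1 := by rw [Set.ncard_compl, Set.ncard_singleton, Nat.card_fin]
  have := p.pos
  omega

theorem exists_forall_isReady_score_le (h : IsGreedyChoice rule G C hist goal) (hk : 0 < k) :
    ∃ p, ∀ v, goal p = some v → ∀ w, IsReady G hist w →
      rule.score G C p w ≤ rule.score G C p v := by
  obtain ⟨order, hgreedy⟩ := h
  refine ⟨order.symm ⟨0, hk⟩, fun v hv w hw => ((hgreedy _).2 v hv).2 w ⟨hw, fun q hq => ?_⟩⟩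
  rw [Equiv.apply_symm_apply] at hq
  exact absurd hq (Nat.not_lt_zero _)

end IsGreedyChoice

/-! ### Ladders -/

/-- The common additional in-neighbours of the two nodes with index `j` of a ladder: nodes of the
path `false` whose indices are chosen by `D j`, restricted to the indices for which they are nodes
of neither of the two path edges into `j`. -/
def rung (n : ℕ) (D : ℕ → Set ℕ) (j : ℕ) : Set (Bool × Fin n) :=
  {u | u.1 = false ∧ u.2.val + 1 < j ∧ j < n ∧ u.2.val ∈ D j}

/-- Two directed paths on `n` nodes each, such that moreover both nodes with index `j` have all
nodes of `rung n D j` as in-neighbours. -/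
abbrev ladder (n : ℕ) (D : ℕ → Set ℕ) : CompDAG where
  V := Bool × Fin n
  finite := inferInstance
  graph := ⟨fun u v => (u.1 = v.1 ∧ u.2.val + 1 = v.2) ∨ u ∈ rung n D v.2⟩
  acyclic v hv := by
    have hlt : Relation.TransGen (· < ·) v.2.val v.2.val :=
      Relation.TransGen.lift (fun u : Bool × Fin n => u.2.val)
        (by rintro u w (⟨_, h⟩ | ⟨_, h, _⟩) <;> simp only [Function.onFun] <;> lia) v v hv
    rw [Relation.transGen_eq_self] at hlt
    exact hlt.false

section Ladder

variable {n : ℕ} {D : ℕ → Set ℕ}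

theorem size_ladder : (ladder n D).size = 2 * n := by simp [CompDAG.size]

theorem rung_eq_empty_of_le {j : ℕ} (h : n ≤ j) : rung n D j = ∅ :=
  Set.eq_empty_of_forall_notMem fun _ hu => h.not_gt hu.2.2.1

theorem lt_of_mem_preds_ladder {u v : (ladder n D).V} (h : u ∈ (ladder n D).preds v) :
    u.2 < v.2 := by
  rcases h with ⟨_, h⟩ | ⟨_, h, _⟩ <;> grind

theorem preds_ladder_zero {b : Bool} (h : 0 < n) :
    (ladder n D).preds (b, ⟨0, h⟩) = ∅ :=
  Set.eq_empty_of_forall_notMem fun u hu => Nat.not_lt_zero u.2 (lt_of_mem_preds_ladder hu)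

theorem preds_ladder_succ {b : Bool} {i : ℕ} (h : i + 1 < n) :
    (ladder n D).preds (b, ⟨i + 1, h⟩) = insert (b, ⟨i, by lia⟩) (rung n D (i + 1)) := by
  ext u
  simp [CompDAG.preds, Prod.ext_iff, Fin.ext_iff]

theorem notMem_rung_succ {b : Bool} {i : ℕ} (h : i < n) : (b, ⟨i, h⟩) ∉ rung n D (i + 1) :=
  fun hu => hu.2.1.false

theorem inDegree_ladder_succ {b : Bool} {i : ℕ} (h : i + 1 < n) :
    (ladder n D).inDegree (b, ⟨i + 1, h⟩) = (rung n D (i + 1)).ncard + 1 := by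
  rw [CompDAG.inDegree, preds_ladder_succ, Set.ncard_insert_of_notMem (notMem_rung_succ _)]

theorem mem_sinks_ladder {v : (ladder n D).V} (h : v.2.val + 1 = n) : v ∈ (ladder n D).sinks := by
  intro w hw
  have := lt_of_mem_preds_ladder (v := w) hw
  grind

theorem isReady_ladder_iff {k i : ℕ} {hist : Fin k → Set (ladder n D).V}
    (hhist : ∀ v : (ladder n D).V, (∃ p, v ∈ hist p) ↔ v.2.val < i) {v : (ladder n D).V} :
    IsReady (ladder n D) hist v ↔ v.2.val = i := by
  rw [IsReady, ← not_exists, hhist, not_lt]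
  simp only [hhist]
  constructor
  · rintro ⟨hle, hpreds⟩
    obtain ⟨b, j, hj⟩ := v
    cases j with
    | zero => exact (Nat.le_zero.1 hle).symm
    | succ j => exact le_antisymm (hpreds (b, ⟨j, by lia⟩) (Or.inl ⟨rfl, rfl⟩)) hle
  · rintro rfl
    exact ⟨le_rfl, fun u hu => lt_of_mem_preds_ladder hu⟩

theorem exists_goal_eq_some {i : ℕ} {rule : GreedyRule} {C : Config (ladder n D).V 2}
    {hist : Fin 2 → Set (ladder n D).V} {goal : Selection (ladder n D).V 2}
    (hhist : ∀ v : (ladder n D).V, (∃ p, v ∈ hist p) ↔ v.2.val < i)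
    (h : IsGreedyChoice rule (ladder n D) C hist goal) :
    ∃ side : Fin 2 ≃ Bool, ∀ p (hi : i < n), goal p = some (side p, ⟨i, hi⟩) := by
  by_cases hi : i < n
  swap
  · exact ⟨finTwoEquiv, fun _ h => absurd h hi⟩
  have hready : {v | IsReady (ladder n D) hist v} = Set.range fun b => (b, ⟨i, hi⟩) := by
    ext v
    rw [Set.mem_ofPred_eq, isReady_ladder_iff hhist]
    exact ⟨fun hv => ⟨v.1, Prod.ext rfl (Fin.ext hv.symm)⟩, by rintro ⟨b, rfl⟩; rfl⟩
  have hinj : Function.Injective fun b : Bool => (b, (⟨i, hi⟩ : Fin n)) :=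
    fun _ _ h => congrArg Prod.fst h
  have htwo : {v | IsReady (ladder n D) hist v}.ncard = 2 := by
    rw [hready, Set.ncard_range_of_injective hinj, Nat.card_eq_fintype_card, Fintype.card_bool]
  choose v hv using h.exists_eq_some_of_le_ncard htwo.ge
  have hidx : ∀ p, (v p).2 = ⟨i, hi⟩ := fun p =>
    Fin.ext ((isReady_ladder_iff hhist).1 (h.isReady (hv p)))
  have hside : Function.Injective fun p => (v p).1 := fun p q hpq =>
    h.eq_of_eq_some (hv p) ((hv q).trans (congrArg some
      (Prod.ext hpq.symm ((hidx q).trans (hidx p).symm))))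
  refine ⟨.ofBijective _ ((Fintype.bijective_iff_injective_and_card _).2 ⟨hside, rfl⟩), ?_⟩
  exact fun p _ => (hv p).trans (congrArg some (Prod.ext rfl (hidx p)))

/-- The state of a greedy pebbling of a ladder when the nodes with index `i` come next: each
processor `p` has computed the nodes of smaller index of the path `side p`, and goes on along it. -/
structure IsAtStage (side : Fin 2 ≃ Bool) (i : ℕ) (C : Config (ladder n D).V 2)
    (hist : Fin 2 → Set (ladder n D).V) (goal : Selection (ladder n D).V 2) : Prop where
  hist_eq : ∀ p, hist p = {v | v.1 = side p ∧ v.2.val < i}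
  goal_eq : ∀ p (hi : i < n), goal p = some (side p, ⟨i, hi⟩)
  red_lt : ∀ p, ∀ v ∈ C.red p, v.2.val < i
  blue_lt : ∀ v ∈ C.blue, v.2.val < i

theorem fin_two_equiv_bool_eq {e e' : Fin 2 ≃ Bool} {p : Fin 2} (h : e p = e' p) : e = e' := by
  decide +revert

namespace IsAtStage

variable {side : Fin 2 ≃ Bool} {i : ℕ} {C : Config (ladder n D).V 2}
  {hist : Fin 2 → Set (ladder n D).V} {goal goal' f : Selection (ladder n D).V 2}
  {rule : GreedyRule}

theorem exists_init (h : IsGreedyChoice rule (ladder n D) (Config.init _ 2) (fun _ => ∅) goal) :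
    ∃ side, IsAtStage side 0 (Config.init (ladder n D).V 2) (fun _ => ∅) goal := by
  obtain ⟨side, hside⟩ := exists_goal_eq_some (i := 0) (by simp) h
  exact ⟨side, ⟨fun p => by simp, hside, fun _ _ h => h.elim, fun _ h => h.elim⟩⟩

theorem apply_of_not_isCompute (h : IsAtStage side i C hist goal) {m : Move (ladder n D).V 2}
    (hm : ¬ m.IsCompute) (happ : m.Applicable (ladder n D) C) :
    IsAtStage side i (m.apply C) hist goal := by
  refine ⟨h.hist_eq, h.goal_eq, fun p v hv => ?_, fun v hv => ?_⟩
  · cases m with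
    | save f => exact h.red_lt p v hv
    | load f => exact hv.elim (h.red_lt p v) fun hv => h.blue_lt v (happ.2 p v hv)
    | compute f => exact (hm trivial).elim
    | removeRed q w => exact h.red_lt p v hv.1
    | removeBlue w => exact h.red_lt p v hv
  · cases m with
    | save f => exact hv.elim (h.blue_lt v) fun ⟨p, hp⟩ => h.red_lt p v (happ.2 p v hp)
    | load f => exact h.blue_lt v hv
    | compute f => exact (hm trivial).elim
    | removeRed q w => exact h.blue_lt v hv
    | removeBlue w => exact h.blue_lt v hv.1

theorem recompute (h : IsAtStage side i C hist goal) (hf : ∀ p v, f p = some v → v ∈ hist p) :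
    IsAtStage side i ((Move.compute f).apply C) hist goal where
  hist_eq := h.hist_eq
  goal_eq := h.goal_eq
  red_lt p v hv := hv.elim (h.red_lt p v) fun hv => (h.hist_eq p ▸ hf p v hv).2
  blue_lt := h.blue_lt

theorem score_lt_score (h : IsAtStage side i C hist goal) (hi : i + 1 < n)
    (hf : ∀ p, f p = some (side p, ⟨i, by lia⟩)) {p : Fin 2} {b : Bool} (hb : b ≠ side p) :
    rule.score (ladder n D) ((Move.compute f).apply C) p (b, ⟨i + 1, hi⟩) <
      rule.score (ladder n D) ((Move.compute f).apply C) p (side p, ⟨i + 1, hi⟩) := by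
  refine rule.score_lt_score (by simp only [inDegree_ladder_succ]) (Set.ncard_lt_ncard ?_)
  have hred : (b, ⟨i, by lia⟩) ∉ ((Move.compute f).apply C).red p := by
    rintro (hmem | hmem)
    · exact (h.red_lt p _ hmem).false
    · exact hb (congrArg Prod.fst (Option.some.inj (hmem.symm.trans (hf p))))
  have hred' : (side p, ⟨i, by lia⟩) ∈ ((Move.compute f).apply C).red p := Or.inr (hf p)
  rw [preds_ladder_succ, preds_ladder_succ, Set.insert_inter_of_notMem hred,
    Set.insert_inter_of_mem hred']
  exact Set.ssubset_insert fun hmem => notMem_rung_succ _ hmem.1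

theorem advance (h : IsAtStage side i C hist goal) (hi : i < n)
    (hf : ∀ p, f p = some (side p, ⟨i, hi⟩))
    (hchoice : IsGreedyChoice rule (ladder n D) ((Move.compute f).apply C)
      (fun p => hist p ∪ {v | f p = some v}) goal') :
    IsAtStage side (i + 1) ((Move.compute f).apply C) (fun p => hist p ∪ {v | f p = some v})
      goal' := by
  have hist_eq : ∀ p, hist p ∪ {v | f p = some v} = {v | v.1 = side p ∧ v.2.val < i + 1} := by
    intro p
    ext v
    simp only [h.hist_eq, hf, Set.mem_union, Set.mem_ofPred_eq, Option.some_inj, Prod.ext_iff,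
      Fin.ext_iff]
    grind
  have hhist : ∀ v, (∃ p, v ∈ hist p ∪ {v | f p = some v}) ↔ v.2.val < i + 1 := fun v => by
    simp only [hist_eq]
    exact ⟨fun ⟨_, _, hv⟩ => hv, fun hv => ⟨side.symm v.1, by simp, hv⟩⟩
  obtain ⟨side', hside'⟩ := exists_goal_eq_some hhist hchoice
  refine ⟨hist_eq, fun p hi' => ?_, fun p v => ?_,
    fun v hv => (h.blue_lt v hv).trans i.lt_succ_self⟩
  · obtain ⟨q, hq⟩ := hchoice.exists_forall_isReady_score_le two_pos
    have hsame : side' q = side q := by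
      by_contra hne
      exact (hq _ (hside' q hi') _ ((isReady_ladder_iff hhist).2 rfl)).not_gt
        (h.score_lt_score hi' hf hne)
    rw [hside', fin_two_equiv_bool_eq hsame]
  · rintro (hv | hv)
    · exact (h.red_lt p v hv).trans i.lt_succ_self
    · obtain rfl := Option.some.inj ((hf p).symm.trans hv)
      exact i.lt_succ_self

theorem le_of_terminal (h : IsAtStage side i C hist goal) (hC : C.Terminal (ladder n D)) :
    n ≤ i := by
  by_contra! hi
  have hlast : n - 1 < i := by
    rcases hC (true, ⟨n - 1, by lia⟩) (mem_sinks_ladder (by simp only; lia)) with hv | ⟨p, hv⟩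
    · exact h.blue_lt _ hv
    · exact h.red_lt p _ hv
  lia

end IsAtStage

/-! ### The I/O cost of greedy pebblings of ladders -/

/-- A potential function for the I/O cost of greedy pebblings of ladders with memory size `r`:
`φ i R B` bounds from below the number of I/O steps still to come when the nodes with index `i` are
computed next, where `R` are the red pebbles of the processor following the path `true` and `B` are
the blue pebbles. -/
structure IsTransferPotential (n : ℕ) (D : ℕ → Set ℕ) (r : ℕ)
    (φ : ℕ → Set (Bool × Fin n) → Set (Bool × Fin n) → ℕ) : Prop where
  eq_zero_of_le : ∀ i R B, n ≤ i → φ i R B = 0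
  anti : ∀ i R R' B B', R ⊆ R' → B ⊆ B' → φ i R' B' ≤ φ i R B
  load : ∀ i R B, ∀ S ⊆ B, S.Subsingleton → φ i R B ≤ φ i (R ∪ S) B + 1
  save : ∀ i R B S, S.Subsingleton → φ i R B ≤ φ i R (B ∪ S ∪ R) + 1
  compute : ∀ i R B S, (∀ v ∈ S, v.1 = true) → φ i R B ≤ φ i (R ∪ S) B
  advance : ∀ i R B, ∀ hi : i < n, (ladder n D).preds (true, ⟨i, hi⟩) ⊆ R →
    (insert (true, ⟨i, hi⟩) R).ncard ≤ r → φ i R B ≤ φ (i + 1) (insert (true, ⟨i, hi⟩) R) B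

theorem subsingleton_setOf_eq_some {α : Type*} (o : Option α) :
    {v | o = some v}.Subsingleton :=
  fun _ hv _ hw => Option.some.inj (hv.symm.trans hw)

namespace IsTransferPotential

variable {r g i : ℕ} {φ : ℕ → Set (Bool × Fin n) → Set (Bool × Fin n) → ℕ}

theorem mul_le_mul_apply_add_cost (hφ : IsTransferPotential n D r φ) {C : Config (ladder n D).V 2}
    {m : Move (ladder n D).V 2} (hm : ¬ m.IsCompute) (happ : m.Applicable (ladder n D) C)
    (p : Fin 2) :
    g * φ i (C.red p) C.blue ≤
      g * φ i ((m.apply C).red p) (m.apply C).blue + m.cost g := by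
  cases m with
  | save f =>
    obtain ⟨q, hq⟩ : ∃ q : Fin 2, ∀ q', q' = p ∨ q' = q := ⟨1 - p, by decide +revert⟩
    have hblue : C.blue ∪ {v | ∃ p, f p = some v} ⊆ C.blue ∪ {v | f q = some v} ∪ C.red p := by
      rintro v (hv | ⟨q', hv⟩)
      · exact Or.inl (Or.inl hv)
      · rcases hq q' with rfl | rfl
        · exact Or.inr (happ.2 _ v hv)
        · exact Or.inl (Or.inr hv)
    calc _ ≤ g * (φ i (C.red p) (C.blue ∪ {v | ∃ p, f p = some v}) + 1) := by
          gcongr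
          exact (hφ.save i _ _ _ (subsingleton_setOf_eq_some (f q))).trans
            (Nat.succ_le_succ (hφ.anti i _ _ _ _ subset_rfl hblue))
      _ = _ := mul_add_one _ _
  | load f =>
    calc _ ≤ g * (φ i (C.red p ∪ {v | f p = some v}) C.blue + 1) := by
          gcongr
          exact hφ.load i _ _ _ (happ.2 p) (subsingleton_setOf_eq_some (f p))
      _ = _ := mul_add_one _ _
  | compute f => exact (hm trivial).elim
  | removeRed q w =>
    exact Nat.mul_le_mul_left g (hφ.anti i _ _ _ _ (fun _ hv => hv.1) subset_rfl)
  | removeBlue w =>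
    exact Nat.mul_le_mul_left g (hφ.anti i _ _ _ _ subset_rfl Set.sdiff_subset)

theorem le_pebblingCost_of_greedyFrom (hφ : IsTransferPotential n D r φ) {rule : GreedyRule}
    {side : Fin 2 ≃ Bool} {C : Config (ladder n D).V 2} {hist : Fin 2 → Set (ladder n D).V}
    {goal : Selection (ladder n D).V 2} {P : List (Move (ladder n D).V 2)}
    (hgreedy : GreedyFrom rule (ladder n D) C hist goal P)
    (hstage : IsAtStage side i C hist goal) (hP : PebblesFrom (ladder n D) r C P) :
    n - i + g * φ i (C.red (side.symm true)) C.blue ≤ pebblingCost g P := by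
  have hside : side (side.symm true) = true := side.apply_symm_apply true
  generalize side.symm true = p at hside ⊢
  induction hgreedy generalizing i with
  | done C hist goal =>
    have hi := hstage.le_of_terminal hP
    simp [hφ.eq_zero_of_le i _ _ hi, hi]
  | other C hist goal m P hm _ ih =>
    have hrest := ih (hstage.apply_of_not_isCompute hm hP.1) hP.2.2
    have hmove := hφ.mul_le_mul_apply_add_cost (g := g) (i := i) hm hP.1 p
    rw [pebblingCost_cons]
    lia
  | recompute C hist goal f P hf _ ih =>
    have hrest := ih (hstage.recompute hf) hP.2.2
    have hmove : φ i (C.red p) C.blue ≤ φ i (C.red p ∪ {v | f p = some v}) C.blue :=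
      hφ.compute i _ _ _ fun v hv => (hstage.hist_eq p ▸ hf p v hv).1.trans hside
    calc _ ≤ n - i + g * φ i (C.red p ∪ {v | f p = some v}) C.blue := by gcongr
      _ ≤ pebblingCost g P := hrest
      _ ≤ _ := Nat.le_add_left _ _
  | advance C hist goal goal' f P hgoal _ hchoice _ ih =>
    rcases le_or_gt n i with hi | hi
    · simp [hφ.eq_zero_of_le i _ _ hi, hi]
    have hf q := hgoal q _ (hstage.goal_eq q hi)
    have hrest := ih (hstage.advance hi hf hchoice) hP.2.2
    have hred : C.red p ∪ {v | f p = some v} = insert (true, ⟨i, hi⟩) (C.red p) := by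
      rw [hf p, hside]
      ext v
      simp [eq_comm]
    have hmove : φ i (C.red p) C.blue ≤ φ (i + 1) (C.red p ∪ {v | f p = some v}) C.blue := by
      rw [hred]
      exact hφ.advance i _ _ hi (hside ▸ hP.1.2 p _ (hf p)) (hred ▸ hP.2.1 p)
    calc _ ≤ n - i + g * φ (i + 1) (C.red p ∪ {v | f p = some v}) C.blue := by gcongr
      _ = 1 + (n - (i + 1) + g * φ (i + 1) (C.red p ∪ {v | f p = some v}) C.blue) := by lia
      _ ≤ _ := Nat.add_le_add_left hrest 1

theorem le_pebblingCost (hφ : IsTransferPotential n D r φ) {rule : GreedyRule}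
    {P : List (Move (ladder n D).V 2)} (hP : IsGreedyPebbling rule (ladder n D) 2 r P) :
    n + g * φ 0 ∅ ∅ ≤ pebblingCost g P :=
  let ⟨hpebbles, _, hchoice, hgreedy⟩ := hP
  let ⟨_, hstage⟩ := IsAtStage.exists_init hchoice
  hφ.le_pebblingCost_of_greedyFrom hgreedy hstage hpebbles

end IsTransferPotential

theorem ncard_sdiff_le_ncard_sdiff_union_add_one {α : Type*} [Finite α] (A R : Set α) {S : Set α}
    (hS : S.Subsingleton) : (A \ R).ncard ≤ (A \ (R ∪ S)).ncard + 1 := calc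
  _ ≤ (A \ (R ∪ S) ∪ S).ncard := Set.ncard_le_ncard (by grind) (Set.toFinite _)
  _ ≤ (A \ (R ∪ S)).ncard + S.ncard := Set.ncard_union_le _ _
  _ ≤ _ := Nat.add_le_add_left (Set.ncard_le_one_iff_subsingleton.2 hS) _

theorem rung_subset_preds {b : Bool} {i : ℕ} (hi : i < n) :
    rung n D i ⊆ (ladder n D).preds (b, ⟨i, hi⟩) := fun _ => Or.inr

theorem sdiff_union_eq_sdiff_of_fst {A R S : Set (Bool × Fin n)} (hA : ∀ v ∈ A, v.1 = false)
    (hS : ∀ v ∈ S, v.1 = true) : A \ (R ∪ S) = A \ R := by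
  ext v
  grind

theorem ncard_inter_le_of_preds_subset {i r : ℕ} {R : Set (Bool × Fin n)} (hi : i < n)
    (hpreds : (ladder n D).preds (true, ⟨i, hi⟩) ⊆ R)
    (hr : (insert (true, ⟨i, hi⟩) R).ncard ≤ r) :
    ((rung n D i ∪ rung n D (i + 1)) ∩ insert (true, ⟨i, hi⟩) R).ncard ≤ r - 2 := by
  set X := (rung n D i ∪ rung n D (i + 1)) ∩ insert (true, ⟨i, hi⟩) R
  have hX : ∀ v ∈ X, v.1 = false := fun v hv => hv.1.elim And.left And.left
  cases i with
  | zero =>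
    have hempty : X = ∅ := Set.eq_empty_of_forall_notMem fun v hv => by
      rcases hv.1 with hv | hv <;> exact absurd hv.2.1 (by lia)
    simp [hempty]
  | succ i =>
    have hsub : insert (true, ⟨i + 1, hi⟩) (insert (true, ⟨i, by lia⟩) X) ⊆
        insert (true, ⟨i + 1, hi⟩) R :=
      Set.insert_subset (Set.mem_insert _ _) (Set.insert_subset
        (Set.mem_insert_of_mem _ (hpreds (Or.inl ⟨rfl, rfl⟩))) Set.inter_subset_right)
    have hcard := (Set.ncard_le_ncard hsub (Set.toFinite _)).trans hr
    rw [Set.ncard_insert_of_notMem, Set.ncard_insert_of_notMem] at hcard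
    · lia
    · exact fun h => Bool.false_ne_true (hX _ h).symm
    · rintro (h | h)
      · simp at h
      · exact Bool.false_ne_true (hX _ h).symm

/-- When the node with index `j` of the path `true` has just been computed, the memory holds it, its
path predecessor and `rung n D j`, so the part of `rung n D (j + 1)` that exceeds the memory is yet
to be loaded. -/
theorem isTransferPotential_of_memory (n : ℕ) (D : ℕ → Set ℕ) (r : ℕ) :
    IsTransferPotential n D r fun i R _ => (rung n D i \ R).ncard +
      ∑ j ∈ Finset.Ico i n, ((rung n D j ∪ rung n D (j + 1)).ncard - (r - 2)) where
  eq_zero_of_le i R _ hi := by simp [rung_eq_empty_of_le hi, hi]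
  anti i R R' _ _ hR _ := by
    gcongr
    exact Set.toFinite _
  load i R _ S _ hS := by
    have := ncard_sdiff_le_ncard_sdiff_union_add_one (rung n D i) R hS
    lia
  save _ _ _ _ _ := Nat.le_succ _
  compute i R _ S hS := by rw [sdiff_union_eq_sdiff_of_fst (fun _ hv => hv.1) hS]
  advance i R _ hi hpreds hr := by
    have hrung : (rung n D i ∪ rung n D (i + 1)) \ insert (true, ⟨i, hi⟩) R ⊆
        rung n D (i + 1) \ insert (true, ⟨i, hi⟩) R := by
      grind [(rung_subset_preds (D := D) hi).trans hpreds]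
    have hsplit := Set.ncard_inter_add_ncard_sdiff_eq_ncard (rung n D i ∪ rung n D (i + 1))
      (insert (true, ⟨i, hi⟩) R) (Set.toFinite _)
    have := Set.ncard_le_ncard hrung (Set.toFinite _)
    have := ncard_inter_le_of_preds_subset hi hpreds hr
    rw [Finset.sum_eq_sum_Ico_succ_bot hi, Set.sdiff_eq_empty.2
      ((rung_subset_preds hi).trans hpreds), Set.ncard_empty]
    lia

theorem le_pebblingCost_of_memory {rule : GreedyRule} {r : ℕ} (g : ℕ)
    {P : List (Move (ladder n D).V 2)} (hP : IsGreedyPebbling rule (ladder n D) 2 r P) :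
    n + g * ∑ j ∈ Finset.range n, ((rung n D j ∪ rung n D (j + 1)).ncard - (r - 2)) ≤
      pebblingCost g P :=
  le_trans (by rw [Finset.range_eq_Ico]; gcongr; exact Nat.le_add_left _ _)
    ((isTransferPotential_of_memory n D r).le_pebblingCost hP)

/-- The nodes of the rungs with index at least `i`. -/
def rungsFrom (n : ℕ) (D : ℕ → Set ℕ) (i : ℕ) : Set (Bool × Fin n) := ⋃ j ≥ i, rung n D j

theorem rungsFrom_subset (i : ℕ) : rungsFrom n D i ⊆ rung n D i ∪ rungsFrom n D (i + 1) := by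
  refine Set.iUnion₂_subset fun j hj => ?_
  rcases hj.eq_or_lt with rfl | hj
  · exact Set.subset_union_left
  · exact (Set.subset_biUnion_of_mem (u := rung n D) hj).trans Set.subset_union_right

theorem fst_of_mem_rungsFrom {i : ℕ} : ∀ v ∈ rungsFrom n D i, v.1 = false := fun v hv => by
  obtain ⟨j, _, hv⟩ := Set.mem_iUnion₂.1 hv
  exact hv.1

theorem rungsFrom_eq_empty_of_le {i : ℕ} (hi : n ≤ i) : rungsFrom n D i = ∅ :=
  Set.subset_empty_iff.1 (Set.iUnion₂_subset fun _ hj =>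
    (rung_eq_empty_of_le (hi.trans hj)).subset)

/-- A rung node has yet to be loaded by the processor following the path `true` and, unless it has
a blue pebble, to be saved before. -/
theorem isTransferPotential_rungsFrom (n : ℕ) (D : ℕ → Set ℕ) (r : ℕ) :
    IsTransferPotential n D r fun i R B =>
      (rungsFrom n D i \ R).ncard + (rungsFrom n D i \ (R ∪ B)).ncard where
  eq_zero_of_le i R B hi := by simp [rungsFrom_eq_empty_of_le hi]
  anti i R R' B B' hR hB := by
    gcongr <;> exact Set.toFinite _
  load i R B S hSB hS := by
    have := ncard_sdiff_le_ncard_sdiff_union_add_one (rungsFrom n D i) R hS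
    rw [Set.union_assoc, Set.union_eq_self_of_subset_left hSB]
    lia
  save i R B S hS := by
    have := ncard_sdiff_le_ncard_sdiff_union_add_one (rungsFrom n D i) (R ∪ B) hS
    rw [show R ∪ (B ∪ S ∪ R) = R ∪ B ∪ S by grind]
    lia
  compute i R B S hS := by
    rw [Set.union_right_comm, sdiff_union_eq_sdiff_of_fst fst_of_mem_rungsFrom hS,
      sdiff_union_eq_sdiff_of_fst fst_of_mem_rungsFrom hS]
  advance i R B hi hpreds _ := by
    have hrung := (rung_subset_preds (D := D) hi).trans hpreds
    have hsdiff : ∀ R' ⊇ R, rungsFrom n D i \ R' ⊆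
        rungsFrom n D (i + 1) \ insert (true, ⟨i, hi⟩) R' := by
      intro R' hR' v hv
      rw [← Set.union_singleton, sdiff_union_eq_sdiff_of_fst fst_of_mem_rungsFrom (by simp)]
      exact ⟨(rungsFrom_subset i hv.1).resolve_left fun h => hv.2 (hR' (hrung h)), hv.2⟩
    rw [Set.insert_union]
    exact Nat.add_le_add (Set.ncard_le_ncard (hsdiff _ subset_rfl) (Set.toFinite _))
      (Set.ncard_le_ncard (hsdiff _ Set.subset_union_left) (Set.toFinite _))

theorem le_pebblingCost_of_rungs {rule : GreedyRule} {r : ℕ} (g : ℕ)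
    {P : List (Move (ladder n D).V 2)} (hP : IsGreedyPebbling rule (ladder n D) 2 r P) :
    n + 2 * g * (⋃ j, rung n D j).ncard ≤ pebblingCost g P := by
  have h := (isTransferPotential_rungsFrom n D r).le_pebblingCost (g := g) hP
  simp only [rungsFrom, ge_iff_le, Nat.zero_le, Set.iUnion_true, Set.union_empty,
    Set.sdiff_empty] at h
  lia

theorem inDegree_ladder_le {d : ℕ} (hd : ∀ j, (rung n D j).ncard ≤ d) (v : (ladder n D).V) :
    (ladder n D).inDegree v ≤ d + 1 := by
  obtain ⟨b, i, hi⟩ := v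
  cases i with
  | zero => simp [CompDAG.inDegree, preds_ladder_zero hi]
  | succ i =>
    rw [inDegree_ladder_succ]
    exact Nat.succ_le_succ (hd _)

end Ladder

/-- The `m` nodes of the path `false` of a ladder with indices from `a` on. -/
def pathSegment (n a m : ℕ) : Set (Bool × Fin n) :=
  {u | u.1 = false ∧ u.2.val ∈ Set.Ico a (a + m)}

theorem ncard_pathSegment {n a m : ℕ} (h : a + m ≤ n) : (pathSegment n a m).ncard = m := by
  let node (j : Fin m) : Bool × Fin n := (false, ⟨a + j, by lia⟩)
  have hrange : pathSegment n a m = Set.range node := by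
    ext ⟨b, j, hj⟩
    constructor
    · rintro ⟨rfl, hle : a ≤ j, hlt : j < a + m⟩
      exact ⟨⟨j - a, by lia⟩, by simp only [node, Nat.add_sub_cancel' hle]⟩
    · rintro ⟨l, hl⟩
      simp only [node, Prod.mk.injEq, Fin.mk.injEq] at hl
      exact ⟨hl.1.symm, by simp [← hl.2]⟩
  have hinj : Function.Injective node := fun j l hjl => by
    simpa [node, Fin.ext_iff] using hjl
  rw [hrange, Set.ncard_range_of_injective hinj, Nat.card_fin]

/-! ### Unbounded memory -/

/-- The ladder in which both nodes with index `j + 2` have the node with index `j` of the path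
`false` as an in-neighbour. -/
abbrev shiftedLadder (n : ℕ) : CompDAG := ladder n fun j => {i | i + 2 = j}

theorem le_pebblingCost_shiftedLadder {rule : GreedyRule} {n r : ℕ} (g : ℕ)
    {P : List (Move (shiftedLadder n).V 2)}
    (hP : IsGreedyPebbling rule (shiftedLadder n) 2 r P) :
    (2 * g + 1) * (n - 2) ≤ pebblingCost g P := by
  have hsub : pathSegment n 0 (n - 2) ⊆ ⋃ j, rung n (fun j => {l | l + 2 = j}) j := by
    rintro v ⟨hv, _, hlt⟩
    exact Set.mem_iUnion.2 ⟨v.2 + 2, hv, by lia, by lia, rfl⟩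
  have hcard : n - 2 ≤ (⋃ j, rung n (fun j => {l | l + 2 = j}) j).ncard :=
    (ncard_pathSegment (by lia)).symm.trans_le (Set.ncard_le_ncard hsub (Set.toFinite _))
  calc (2 * g + 1) * (n - 2) ≤ n + 2 * g * (n - 2) := by lia
    _ ≤ n + 2 * g * _ := by gcongr
    _ ≤ pebblingCost g P := le_pebblingCost_of_rungs g hP

/-! ### Limited memory -/

/-- The nodes with odd and those with even index have different blocks of `m` nodes as additional
in-neighbours. -/
def alternatingBlocks (m j : ℕ) : Set ℕ :=
  {l | 2 * m < j ∧ l ∈ Set.Ico (m * (j % 2)) (m * (j % 2) + m)}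

section AlternatingBlocks

variable {n m i : ℕ} {D : ℕ → Set ℕ}

theorem rung_alternatingBlocks_subset (j : ℕ) :
    rung n (alternatingBlocks m) j ⊆ pathSegment n (m * (j % 2)) m :=
  fun _ hu => ⟨hu.1, hu.2.2.2.2⟩

theorem mul_mod_two_add_le (m j : ℕ) : m * (j % 2) + m ≤ 2 * m := by
  rcases Nat.mod_two_eq_zero_or_one j with h | h <;> rw [h] <;> lia

theorem rung_alternatingBlocks {j : ℕ} (hj : 2 * m < j) (hjn : j < n) :
    rung n (alternatingBlocks m) j = pathSegment n (m * (j % 2)) m := by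
  refine (rung_alternatingBlocks_subset j).antisymm fun u hu => ⟨hu.1, ?_, hjn, hj, hu.2⟩
  have hlt : u.2.val < m * (j % 2) + m := hu.2.2
  have := mul_mod_two_add_le m j
  lia

theorem ncard_rung_alternatingBlocks_le (j : ℕ) : (rung n (alternatingBlocks m) j).ncard ≤ m := by
  by_cases hj : 2 * m < j ∧ j < n
  · exact (Set.ncard_le_ncard (rung_alternatingBlocks_subset j) (Set.toFinite _)).trans_eq
      (ncard_pathSegment ((mul_mod_two_add_le m j).trans (hj.1.trans hj.2).le))
  · have hempty : rung n (alternatingBlocks m) j = ∅ :=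
      Set.eq_empty_of_forall_notMem fun u hu => hj ⟨hu.2.2.2.1, hu.2.2.1⟩
    simp [hempty]

theorem pathSegment_subset_rung_union_rung {j : ℕ} (hj : 2 * m < j) (hjn : j + 1 < n) :
    pathSegment n 0 (2 * m) ⊆
      rung n (alternatingBlocks m) j ∪ rung n (alternatingBlocks m) (j + 1) := by
  rw [rung_alternatingBlocks hj (by lia), rung_alternatingBlocks (by lia) hjn]
  rintro u ⟨hu, _, hlt⟩
  rw [zero_add] at hlt
  rcases Nat.mod_two_eq_zero_or_one j with h | h
  · rw [show (j + 1) % 2 = 1 by lia, h]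
    rcases lt_or_ge u.2.val m with hum | hum
    · exact Or.inl ⟨hu, by simpa⟩
    · exact Or.inr ⟨hu, by lia, by lia⟩
  · rw [show (j + 1) % 2 = 0 by lia, h]
    rcases lt_or_ge u.2.val m with hum | hum
    · exact Or.inr ⟨hu, by simpa⟩
    · exact Or.inl ⟨hu, by lia, by lia⟩

theorem le_pebblingCost_alternatingBlocks {rule : GreedyRule} (g : ℕ)
    {P : List (Move (ladder n (alternatingBlocks m)).V 2)}
    (hP : IsGreedyPebbling rule (ladder n (alternatingBlocks m)) 2 (m + 2) P) :
    (g * m + 1) * (n - (2 * m + 2)) ≤ pebblingCost g P := by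
  set l := n - (2 * m + 2)
  set excess := fun j => (rung n (alternatingBlocks m) j ∪
    rung n (alternatingBlocks m) (j + 1)).ncard - (m + 2 - 2)
  have hexcess : ∀ j ∈ Finset.Ico (2 * m + 1) (2 * m + 1 + l), m ≤ excess j := by
    intro j hj
    rw [Finset.mem_Ico] at hj
    have := Set.ncard_le_ncard (pathSegment_subset_rung_union_rung (n := n) (m := m)
      (j := j) (by lia) (by lia)) (Set.toFinite _)
    rw [ncard_pathSegment (by lia)] at this
    simp only [excess]
    lia
  have hsum : l * m ≤ ∑ j ∈ Finset.range n, excess j := calc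
    l * m = (Finset.Ico (2 * m + 1) (2 * m + 1 + l)).card • m := by simp
    _ ≤ ∑ j ∈ Finset.Ico (2 * m + 1) (2 * m + 1 + l), excess j :=
      Finset.card_nsmul_le_sum _ _ _ hexcess
    _ ≤ ∑ j ∈ Finset.range n, excess j :=
      Finset.sum_le_sum_of_subset fun j hj => by
        simp only [Finset.mem_Ico, Finset.mem_range] at hj ⊢
        lia
  calc (g * m + 1) * l = l + g * (l * m) := by ring
    _ ≤ n + g * ∑ j ∈ Finset.range n, excess j := by gcongr; lia
    _ ≤ pebblingCost g P := le_pebblingCost_of_memory g hP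

/-- The nodes that are saved before round `i` of the cheap strategy, which computes the path `true`
one node ahead of the path `false`: so the two nodes computed in one round have different blocks of
in-neighbours. -/
def savedBefore (n i : ℕ) : Set (Bool × Fin n) := {v | v.2.val < i + v.1.toNat}

theorem isPredClosed_savedBefore : (ladder n D).IsPredClosed (savedBefore n i) := by
  rintro v hv u (⟨hu, hlt⟩ | ⟨hu, hlt, _⟩)
  · simp only [savedBefore, Set.mem_ofPred_eq, hu] at hv ⊢
    lia
  · have := v.1.toNat_le
    simp only [savedBefore, Set.mem_ofPred_eq, hu, Bool.toNat_false] at hv ⊢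
    lia

theorem ncard_savedBefore_le (h : i < n) : (savedBefore n i).ncard ≤ 2 * (i + 1) := by
  have hsub : savedBefore n i ⊆
      Set.range (Prod.map id (Fin.castLE h) : Bool × Fin (i + 1) → Bool × Fin n) := by
    intro v hv
    have := v.1.toNat_le
    simp only [savedBefore, Set.mem_ofPred_eq] at hv
    exact ⟨(v.1, ⟨v.2, by lia⟩), rfl⟩
  calc _ ≤ _ := Set.ncard_le_ncard hsub (Set.toFinite _)
    _ = 2 * (i + 1) := by
      rw [Set.ncard_range_of_injective (Function.injective_id.prodMap (Fin.castLE_injective h))]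
      simp

theorem subsingleton_setOf_add_eq_add_toNat (i e p : ℕ) :
    {v : Bool × Fin n | v.2.val + e = i + v.1.toNat ∧ (v.2.val + e) % 2 = p}.Subsingleton := by
  rintro ⟨b, j⟩ ⟨hj, hjp⟩ ⟨b', j'⟩ ⟨hj', hjp'⟩
  have := b.toNat_le
  have := b'.toNat_le
  have hb : b.toNat = b'.toNat := by lia
  exact Prod.ext (by cases b <;> cases b' <;> trivial) (Fin.ext (by lia))

theorem block_end_le (m : ℕ) (p : Fin 2) : m * p + m ≤ 2 * m := by
  have := mul_mod_two_add_le m p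
  rwa [Nat.mod_eq_of_lt p.isLt] at this

theorem ncard_block (h : 2 * m ≤ n) (p : Fin 2) : (pathSegment n (m * p) m).ncard = m :=
  ncard_pathSegment ((block_end_le m p).trans h)

theorem completableWithin_savedBefore_succ {g c : ℕ} (hi : 2 * m < i) (hin : i < n)
    (h : CompletableWithin (k := 2) (ladder n (alternatingBlocks m)) (m + 2) g
      ⟨fun p => pathSegment n (m * p) m, savedBefore n (i + 1)⟩ c) :
    CompletableWithin (k := 2) (ladder n (alternatingBlocks m)) (m + 2) g
      ⟨fun p => pathSegment n (m * p) m, savedBefore n i⟩ (c + (2 * g + 1)) := by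
  let loaded (p : Fin 2) : Set (Bool × Fin n) :=
    {v | v.2.val + 1 = i + v.1.toNat ∧ (v.2.val + 1) % 2 = p}
  let computed (p : Fin 2) : Set (Bool × Fin n) := {v | v.2.val = i + v.1.toNat ∧ v.2.val % 2 = p}
  have hsaved : savedBefore n i ∪ ⋃ p, computed p = savedBefore n (i + 1) := by
    ext v
    simp only [savedBefore, computed, Set.mem_union, Set.mem_iUnion, Set.mem_ofPred_eq]
    refine ⟨?_, fun hv => ?_⟩
    · rintro (hv | ⟨_, hv, _⟩) <;> lia
    · rcases lt_or_ge v.2.val (i + v.1.toNat) with hlt | hge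
      · exact Or.inl hlt
      · exact Or.inr ⟨⟨v.2 % 2, by lia⟩, by lia, rfl⟩
  refine CompletableWithin.loadComputeSave (A := loaded) (A' := computed)
    (fun p => subsingleton_setOf_add_eq_add_toNat i 1 p)
    (fun p => subsingleton_setOf_add_eq_add_toNat i 0 p)
    ⟨⟨i % 2, by lia⟩, (false, ⟨i - 1, by lia⟩), Nat.sub_add_cancel (by lia),
      congrArg (· % 2) (Nat.sub_add_cancel (by lia))⟩
    ⟨⟨i % 2, by lia⟩, (false, ⟨i, hin⟩), rfl, rfl⟩
    (fun p v hv => by have := hv.1; simp only [savedBefore, Set.mem_ofPred_eq]; lia)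
    ?_ (fun p => ?_) (hsaved ▸ h)
  · rintro p v ⟨hv, hvp⟩ u (⟨hu, huv⟩ | hu)
    · exact Or.inr ⟨by rw [huv, hv, hu], huv ▸ hvp⟩
    · exact Or.inl (hvp ▸ rung_alternatingBlocks_subset _ hu)
  · rw [ncard_block (by lia)]

theorem completableWithin_savedBefore {g d : ℕ} (hi : 2 * m < i) (hn : i + d = n) :
    CompletableWithin (k := 2) (ladder n (alternatingBlocks m)) (m + 2) g
      ⟨fun p => pathSegment n (m * p) m, savedBefore n i⟩ (d * (2 * g + 1)) := by
  induction d generalizing i with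
  | zero =>
    rw [zero_mul]
    refine .of_terminal (fun p => ?_) fun v _ => Or.inl ?_
    · have := ncard_block (n := n) (m := m) (by lia) p
      lia
    · have := v.2.isLt
      simp only [savedBefore, Set.mem_ofPred_eq]
      lia
  | succ d ih =>
    rw [Nat.succ_mul]
    exact completableWithin_savedBefore_succ hi (by lia) (ih (by lia) (by lia))

theorem pebblingOPT_alternatingBlocks_le (g : ℕ) (hn : 2 * m + 2 ≤ n) :
    pebblingOPT (ladder n (alternatingBlocks m)) 2 (m + 2) g ≤
      (2 * g + 1) * (n - (2 * m + 2)) +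
        ((2 * g + 1) + g * (2 * m) + 2 * (2 * m + 2) * (g * (m + 2) + 1)) := by
  have hsaved : ∀ p : Fin 2, pathSegment n (m * p) m ⊆ savedBefore n (2 * m + 1) :=
    fun p v ⟨_, _, hlt⟩ => by
      have := block_end_le m p
      simp only [savedBefore, Set.mem_ofPred_eq]
      lia
  have hmain := completableWithin_savedBefore (n := n) (m := m) (g := g) (d := n - (2 * m + 1))
    (Nat.lt_succ_self (2 * m)) (by lia)
  have hblocks : Function.update (Function.update (fun _ => ∅) 0 (∅ ∪ pathSegment n (m * 0) m)) 1
      (∅ ∪ pathSegment n (m * 1) m) = fun p : Fin 2 => pathSegment n (m * p) m := by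
    funext p
    fin_cases p <;> simp
  rw [← hblocks] at hmain
  have hload := CompletableWithin.loadSet (R := fun _ => ∅) 0 (hsaved 0)
    (CompletableWithin.loadSet 1 (hsaved 1) hmain)
  have hinit := CompletableWithin.savePredClosed 0 isPredClosed_savedBefore
    (fun v => Nat.succ_le_succ (inDegree_ladder_le ncard_rung_alternatingBlocks_le v)) hload
  refine hinit.pebblingOPT_le.trans ?_
  rw [ncard_pathSegment (by lia), ncard_pathSegment (by lia)]
  have := ncard_savedBefore_le (n := n) (i := 2 * m + 1) (by lia)
  calc _ ≤ (n - (2 * m + 1)) * (2 * g + 1) + g * m + g * m +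
        2 * (2 * m + 1 + 1) * (g * (m + 2) + 1) := by gcongr
    _ = _ := by rw [show n - (2 * m + 1) = n - (2 * m + 2) + 1 by lia]; ring

theorem maxInDegree_alternatingBlocks (hn : 2 * m + 2 ≤ n) :
    (ladder n (alternatingBlocks m)).maxInDegree = m + 1 := by
  refine le_antisymm
    (ciSup_le' (inDegree_ladder_le ncard_rung_alternatingBlocks_le)) ?_
  have hv : (ladder n (alternatingBlocks m)).inDegree (false, ⟨2 * m + 1, hn⟩) = m + 1 := by
    rw [inDegree_ladder_succ, rung_alternatingBlocks (Nat.lt_succ_self _) hn,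
      ncard_pathSegment ((mul_mod_two_add_le _ _).trans (by lia))]
  exact hv.symm.trans_le (le_ciSup (Set.finite_range _).bddAbove _)

end AlternatingBlocks

/-- The DAG with `n` nodes and no edges. -/
abbrev edgeless (n : ℕ) : CompDAG where
  V := Fin n
  finite := inferInstance
  graph := ⊥
  acyclic _ h := by
    cases h with
    | single h => exact h
    | tail _ h => exact h

theorem maxInDegree_edgeless (n : ℕ) : (edgeless n).maxInDegree = 0 := by
  have hpreds : ∀ v, (edgeless n).preds v = ∅ := fun _ =>
    Set.eq_empty_of_forall_notMem fun _ h => h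
  exact Nat.le_zero.1 (ciSup_le' fun v => by rw [CompDAG.inDegree, hpreds, Set.ncard_empty])

/-! ### Asymptotic factors -/

namespace GreedyWorseByFactor

variable {k g : ℕ} {r : ℕ → ℕ} {G : ℕ → CompDAG} {c : ℝ}

theorem mono {c' : ℝ} (h : GreedyWorseByFactor k g r G c) (hc : c' ≤ c) :
    GreedyWorseByFactor k g r G c' := fun rule ε hε =>
  (h rule ε hε).mono fun _ hi P hP => le_trans (by gcongr) (hi P hP)

theorem of_le_one (hc : c ≤ 1) : GreedyWorseByFactor k g r G c :=
  fun rule ε hε => .of_forall fun i P hP => calc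
    (c - ε) * (pebblingOPT (G i) k (r i) g : ℝ) ≤ 1 * pebblingOPT (G i) k (r i) g := by
      gcongr
      linarith
    _ = pebblingOPT (G i) k (r i) g := one_mul _
    _ ≤ pebblingCost g P := Nat.cast_le.2 (Nat.sInf_le ⟨P, hP.1, rfl⟩)

theorem of_linear {a b K : ℕ} (ha : 0 < a) (hOPT : ∀ i, pebblingOPT (G i) k (r i) g ≤ a * i + K)
    (hgreedy : ∀ i rule P, IsGreedyPebbling rule (G i) k (r i) P → b * i ≤ pebblingCost g P) :
    GreedyWorseByFactor k g r G (b / a) := by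
  intro rule ε hε
  have : (0 : ℝ) < a := Nat.cast_pos.2 ha
  filter_upwards [tendsto_natCast_atTop_atTop.eventually_ge_atTop
    ((b / a - ε) * K / (ε * a) : ℝ)] with i hi P hP
  rw [div_le_iff₀ (by positivity)] at hi
  have hcost : (b * i : ℝ) ≤ pebblingCost g P := mod_cast hgreedy i rule P hP
  rcases le_total ((b : ℝ) / a - ε) 0 with hneg | hpos
  · exact (mul_nonpos_of_nonpos_of_nonneg hneg (Nat.cast_nonneg _)).trans (Nat.cast_nonneg _)
  · calc ((b : ℝ) / a - ε) * pebblingOPT (G i) k (r i) g ≤ (b / a - ε) * (a * i + K) := by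
          gcongr
          exact_mod_cast hOPT i
      _ = b * i + ((b / a - ε) * K - i * (ε * a)) := by field_simp; ring
      _ ≤ b * i := by linarith
      _ ≤ pebblingCost g P := hcost

end GreedyWorseByFactor

theorem greedyWorseByFactor_alternatingBlocks (m g : ℕ) :
    GreedyWorseByFactor 2 g (fun _ => m + 2)
      (fun i => ladder (i + (2 * m + 2)) (alternatingBlocks m)) ((g * m + 1) / (2 * g + 1)) := by
  refine mod_cast GreedyWorseByFactor.of_linear (a := 2 * g + 1) (b := g * m + 1)
    (K := (2 * g + 1) + g * (2 * m) + 2 * (2 * m + 2) * (g * (m + 2) + 1))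
    (by positivity) (fun i => ?_) fun i rule P hP => ?_
  · exact (pebblingOPT_alternatingBlocks_le g (Nat.le_add_left _ i)).trans_eq
      (by rw [Nat.add_sub_cancel])
  · simpa using le_pebblingCost_alternatingBlocks g hP

theorem greedyWorseByFactor_shiftedLadder {r : ℕ → ℕ} (g : ℕ)
    (hr : ∀ i, (shiftedLadder (i + 2)).size ≤ r i) :
    GreedyWorseByFactor 2 g r (fun i => shiftedLadder (i + 2)) ((2 * g + 1) / 2) := by
  refine mod_cast GreedyWorseByFactor.of_linear (a := 2) (b := 2 * g + 1) (K := 4)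
    two_pos (fun i => ?_) fun i rule P hP => ?_
  · exact (pebblingOPT_le_size 0 (hr i)).trans_eq (size_ladder.trans (by ring))
  · simpa using le_pebblingCost_shiftedLadder g hP

theorem tendsto_size_ladder (D : ℕ → Set ℕ) (a : ℕ) :
    Tendsto (fun i => (ladder (i + a) D).size) atTop atTop :=
  tendsto_atTop_mono (fun i => size_ladder.symm ▸ (by lia : i ≤ 2 * (i + a))) tendsto_id

theorem div_five_sub_one_le {d g : ℝ} (hd : 0 ≤ d) (hg : 1 ≤ g) :
    d / 5 - 1 ≤ (g * (d - 1) + 1) / (2 * g + 1) := by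
  rw [le_div_iff₀ (by positivity)]
  nlinarith [mul_nonneg hd (sub_nonneg.2 hg)]

theorem mainTheorem5_general :
    (∀ Δ g : ℕ, ∃ G : ℕ → CompDAG,
      Tendsto (fun i => (G i).size) atTop atTop ∧ (∀ i, (G i).maxInDegree = Δ) ∧
      GreedyWorseByFactor 2 g (fun _ => Δ + 1) G ((g * ((Δ : ℝ) - 1) + 1) / (2 * g + 1))) ∧
    ∃ G : ℕ → CompDAG, Tendsto (fun i => (G i).size) atTop atTop ∧
      ∀ (g : ℕ) (r : ℕ → ℕ), (∀ i, (G i).size ≤ r i) →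
        GreedyWorseByFactor 2 g r G (g + 1 / 2) := by
  refine ⟨fun Δ g => ?_, fun i => shiftedLadder (i + 2), tendsto_size_ladder _ 2, fun g r hr => ?_⟩
  · cases Δ with
    | zero =>
      have hsize : Tendsto (fun i => (edgeless i).size) atTop atTop :=
        tendsto_atTop_mono (fun i => (Nat.card_fin i).ge) tendsto_id
      refine ⟨edgeless, hsize, maxInDegree_edgeless, .of_le_one ?_⟩
      rw [div_le_one (by positivity)]
      have : (0 : ℝ) ≤ g := g.cast_nonneg
      push_cast
      linarith
    | succ m =>
      refine ⟨_, tendsto_size_ladder (alternatingBlocks m) (2 * m + 2),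
        fun i => maxInDegree_alternatingBlocks (Nat.le_add_left _ i), ?_⟩
      simpa using greedyWorseByFactor_alternatingBlocks m g
  · exact (greedyWorseByFactor_shiftedLadder g hr).mono (by linarith)

theorem mainTheorem5 :
    (∀ Δ g : ℕ, 1 ≤ g →
      ∃ (G : ℕ → CompDAG) (r : ℕ),
        Tendsto (fun i => (G i).size) atTop atTop ∧
        (∀ i, (G i).maxInDegree = Δ) ∧
        Δ + 1 ≤ r ∧
        GreedyWorseByFactor 2 g (fun _ => r) G ((Δ : ℝ) / 5 - 1)) ∧
    (∀ g : ℕ, 2 ≤ g →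
      ∃ G : ℕ → CompDAG,
        Tendsto (fun i => (G i).size) atTop atTop ∧
        ∀ r : ℕ → ℕ, (∀ i, (G i).size ≤ r i) →
          GreedyWorseByFactor 2 g r G (2 * (g : ℝ) / 3 + 1)) := by
  obtain ⟨hlimited, G, hsize, hunbounded⟩ := mainTheorem5_general
  refine ⟨fun Δ g hg => ?_, fun g hg => ⟨G, hsize, fun r hr =>
    (hunbounded g r hr).mono (by linarith [Nat.ofNat_le_cast (α := ℝ).2 hg])⟩⟩
  obtain ⟨G, hsize, hdeg, hG⟩ := hlimited Δ g
  exact ⟨G, Δ + 1, hsize, hdeg, le_rfl,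
    hG.mono (div_five_sub_one_le Δ.cast_nonneg (Nat.one_le_cast.2 hg))⟩
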